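/- Let $(F_n)_{n\ge 0}$ be the Fibonacci sequence ($F_0=0$, $F_1=1$, $F_{n+2}=F_{n+1}+F_n$), let $\varphi=(1+\sqrt5)/2$, and for $z\in\mathbb{C}\setminus(-\infty,0]$ and $\operatorname{Re}(s)>0$ put $$\zeta_F(s,z)=\sum_{n=0}^{\infty}(z+F_n)^{-s},$$ with the principal branch of the logarithm. This series converges absolutely, and for every $z\in\mathbb{C}\setminus(-\infty,0]$ the function $s\mapsto\zeta_F(s,z)$ has a meromorphic continuation to all of $\mathbb{C}$. The continuation is holomorphic except for at most simple poles at the points $$s=-\ell\quad(\ell\in\mathbb{N}_0),\qquad s=-\ell-2k+\frac{(2n+k)\pi i}{\log\varphi}\quad(\ell,k\in\mathbb{N}_0),$$ where $n\in\mathbb{Z}$ if $k$ is odd and $n\in\mathbb{Z}\setminus\{-k/2\}$ if $k$ is even. Each of these points is a simple pole of $\zeta_F(\cdot,z)$ for all $z\in\mathbb{C}\setminus(-\infty,0]$ outside a finite set (depending on the point). For every $\ell\in\mathbb{N}_0$ and every $z\in\mathbb{C}\setminus(-\infty,0]$, $$\operatorname*{Res}_{s=-\ell}\zeta_F(s,z)=\frac{1}{\log\varphi}\sum_{j=0}^{\lfloor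 \ell/4\rfloor}\binom{4j}{2j}\binom{\ell}{4j}5^{-2j}z^{\ell-4j},$$ where $\binom{4j}{2j}\binom{\ell}{4j}=\frac{\ell!}{(2j)!\,(2j)!\,(\ell-4j)!}$ (and where the residue is $0$ if $-\ell$ happens not to be a pole). -/

import Mathlib

open Filter Topology

/-- The point `-ℓ - 2k + (2n + k) π i / log φ`, where `φ` is the golden ratio. -/
noncomputable def fibPole (ℓ k : ℕ) (n : ℤ) : ℂ :=
  -(ℓ : ℂ) - 2 * (k : ℂ)
    + (2 * (n : ℂ) + (k : ℂ)) * (Real.pi : ℂ) * Complex.I / (Real.log Real.goldenRatio : ℂ)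

/-- The listed points: the non-positive integers `-ℓ`, and the points `fibPole ℓ k n`, where `n` is
any integer if `k` is odd and any integer other than `-k/2` if `k` is even. -/
def fibPoles : Set ℂ :=
  {p | (∃ ℓ : ℕ, p = -(ℓ : ℂ)) ∨ ∃ (ℓ k : ℕ) (n : ℤ), 2 * n + (k : ℤ) ≠ 0 ∧ p = fibPole ℓ k n}

/-- `f` has residue `r` at `p`, for `f` with at most a simple pole at `p`. -/
def HasSimpleResidueAt (f : ℂ → ℂ) (p r : ℂ) : Prop :=
  MeromorphicAt f p ∧ -1 ≤ meromorphicOrderAt f p ∧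
    Tendsto (fun s => (s - p) * f s) (𝓝[≠] p) (𝓝 r)

/-- `f` has a (genuine) simple pole at `p`. -/
def HasSimplePoleAt (f : ℂ → ℂ) (p : ℂ) : Prop :=
  MeromorphicAt f p ∧ meromorphicOrderAt f p = -1

/-! By Binet, `z + F_n = (φ^n / √5) (1 + √5 z φ^(-n) - (-1)^n φ^(-2n))`. Once `n ≥ N`, with `N`
large in terms of `z`, the power `-s` of the bracket expands in a double binomial series over `(j,
k)`, whose terms depend on `n` only through the `n`-th power of `fibRatio (j, k) s`. Summing over `n
≥ N` first turns the tail, for `Re s > 0`, into a series of terms `fibTerm` with denominators `1 -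
fibRatio` (`hasSum_add_fib_cpow`). That series makes sense for every `s`: on a disc only finitely
many denominators can vanish, and the rest of the series is dominated by a convergent binomial
series (`fibZetaAux_eventuallyEq`). The poles are the solutions of `fibRatio = 1`, and the residue
there is a polynomial in `z`. Distinct contributing `(j, k)` have distinct `j`, so this polynomial
is nonzero and has finitely many roots. -/

/-! ### Generalized binomial coefficients and the double binomial series -/

theorem Ring.succ_mul_choose_succ {K : Type*} [Field K] [CharZero K] (a : K) (r : ℕ) :
    ((r : K) + 1) * Ring.choose a (r + 1) = (a - r) * Ring.choose a r := by
  have h0 : (r.factorial : K) ≠ 0 := by exact_mod_cast r.factorial_ne_zero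
  have h1 := Ring.descPochhammer_eq_factorial_smul_choose a (r + 1)
  have h2 := Ring.descPochhammer_eq_factorial_smul_choose a r
  rw [descPochhammer_succ_right, Polynomial.smeval_mul, h2] at h1
  simp only [Polynomial.smeval_sub, Polynomial.smeval_X, Polynomial.smeval_natCast, pow_one,
    pow_zero, nsmul_eq_mul, Nat.factorial_succ, Nat.cast_mul, Nat.cast_add, Nat.cast_one,
    mul_one] at h1
  apply mul_left_cancel₀ h0
  linear_combination -h1

theorem Ring.choose_succ_eq_div {K : Type*} [Field K] [CharZero K] (a : K) (r : ℕ) :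
    Ring.choose a (r + 1) = (a - r) * Ring.choose a r / ((r : K) + 1) := by
  have h : (r : K) + 1 ≠ 0 := by exact_mod_cast r.succ_ne_zero
  rw [eq_div_iff h, mul_comm, Ring.succ_mul_choose_succ]

/-- Factor by factor, `‖-s - r‖ ≤ R + r`. This makes the later majorant uniform on discs. -/
theorem norm_choose_neg_le {s : ℂ} {R : ℝ} (h : ‖s‖ ≤ R) (r : ℕ) :
    ‖Ring.choose (-s) r‖ ≤ ‖Ring.choose (-(R : ℂ)) r‖ := by
  have hR : 0 ≤ R := (norm_nonneg s).trans h
  induction r with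
  | zero => simp
  | succ r ih =>
    rw [Ring.choose_succ_eq_div, Ring.choose_succ_eq_div, norm_div, norm_div, norm_mul, norm_mul]
    have h1 : ‖-s - r‖ ≤ ‖-(R : ℂ) - r‖ := by
      have : -(R : ℂ) - r = ((-(R + r) : ℝ) : ℂ) := by push_cast; ring
      rw [this, Complex.norm_real, Real.norm_eq_abs, abs_neg, abs_of_nonneg (by positivity)]
      calc ‖-s - r‖ ≤ ‖-s‖ + ‖(r : ℂ)‖ := norm_sub_le _ _
        _ ≤ R + r := by simpa using h
    gcongr

theorem differentiable_choose_neg (r : ℕ) :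
    Differentiable ℂ fun s : ℂ => Ring.choose (-s) r := by
  induction r with
  | zero => simp
  | succ r ih =>
    simp only [Ring.choose_succ_eq_div]
    fun_prop

theorem choose_neg_ne_zero {s : ℂ} (h : s.im ≠ 0) (r : ℕ) : Ring.choose (-s) r ≠ 0 := by
  induction r with
  | zero => simp
  | succ r ih =>
    rw [Ring.choose_succ_eq_div]
    refine div_ne_zero (mul_ne_zero (fun h0 => h ?_) ih) (by exact_mod_cast r.succ_ne_zero)
    simpa using congrArg Complex.im h0

theorem hasSum_choose_mul_pow (a : ℂ) {x : ℂ} (hx : ‖x‖ < 1) :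
    HasSum (fun r : ℕ => Ring.choose a r * x ^ r) ((1 + x) ^ a) := by
  have h := (Complex.one_add_cpow_hasFPowerSeriesOnBall_zero (a := a)).hasSum (y := x)
    (by rw [← ENNReal.ofReal_one, Metric.eball_ofReal]; simpa using hx)
  simpa [binomialSeries, mul_comm] using h

theorem summable_norm_choose_mul_pow (a : ℂ) {ρ : ℝ} (h0 : 0 ≤ ρ) (h1 : ρ < 1) :
    Summable (fun r : ℕ => ‖Ring.choose a r‖ * ρ ^ r) := by
  have h := (hasSum_choose_mul_pow a (x := (ρ : ℂ))
    (by rwa [Complex.norm_real, Real.norm_eq_abs, abs_of_nonneg h0])).summable.norm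
  simpa [abs_of_nonneg h0] using h

theorem sum_choose_mul_pow_antidiagonal {A : Type*} [CommSemiring A] (c : ℕ → A) (a b : A) (r : ℕ) :
    ∑ p ∈ Finset.HasAntidiagonal.antidiagonal r, c (p.1 + p.2) * (p.1 + p.2).choose p.2 * a ^ p.1 * b ^ p.2 =
      c r * (a + b) ^ r := by
  rw [add_comm a b, (Commute.all b a).add_pow', ← Finset.Nat.sum_antidiagonal_swap, Finset.mul_sum]
  refine Finset.sum_congr rfl fun p hp => ?_
  have hp := Finset.HasAntidiagonal.mem_antidiagonal.1 hp
  simp only [Prod.fst_swap, Prod.snd_swap, add_comm p.2 p.1, hp, nsmul_eq_mul]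
  have : r.choose p.1 = r.choose p.2 := by
    rw [← hp, Nat.choose_symm_add]
  rw [this]
  ring

/-- Grouping the nonnegative terms by `j + k = r` gives the binomial series at `α + β`. -/
theorem summable_double_binomial (a : ℂ) {α β : ℝ} (hα : 0 ≤ α) (hβ : 0 ≤ β) (h : α + β < 1) :
    Summable (fun p : ℕ × ℕ =>
      ‖Ring.choose a (p.1 + p.2)‖ * (p.1 + p.2).choose p.2 * α ^ p.1 * β ^ p.2) := by
  rw [← (Finset.HasAntidiagonal.sigmaAntidiagonalEquivProd (A := ℕ)).summable_iff,
    summable_sigma_of_nonneg (fun _ => by simp only [Function.comp]; positivity)]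
  refine ⟨fun r => Summable.of_finite, ?_⟩
  refine (summable_norm_choose_mul_pow a (by positivity) h).congr fun r => ?_
  rw [tsum_fintype, ← sum_choose_mul_pow_antidiagonal (fun r => ‖Ring.choose a r‖),
    ← Finset.sum_coe_sort]
  rfl

theorem hasSum_double_binomial (s : ℂ) {a b : ℂ} (h : ‖a‖ + ‖b‖ < 1) :
    HasSum (fun p : ℕ × ℕ =>
      Ring.choose s (p.1 + p.2) * (p.1 + p.2).choose p.2 * a ^ p.1 * b ^ p.2)
      ((1 + (a + b)) ^ s) := by
  have hs : Summable (fun p : ℕ × ℕ =>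
      Ring.choose s (p.1 + p.2) * (p.1 + p.2).choose p.2 * a ^ p.1 * b ^ p.2) := by
    refine .of_norm ((summable_double_binomial s (norm_nonneg a) (norm_nonneg b) h).congr
      fun p => ?_)
    simp
  have hs' := (Finset.HasAntidiagonal.sigmaAntidiagonalEquivProd (A := ℕ)).summable_iff.2 hs
  have h1 := hs'.hasSum.sigma (fun r => hasSum_fintype _)
  have h2 := hasSum_choose_mul_pow s ((norm_add_le a b).trans_lt h)
  have h3 : (fun r => Ring.choose s r * (a + b) ^ r) = _ := funext fun r =>
    ((sum_choose_mul_pow_antidiagonal (Ring.choose s) a b r).symm.trans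
      (Finset.sum_coe_sort _ _).symm)
  rw [h3] at h2
  rw [h2.unique h1, ← (Finset.HasAntidiagonal.sigmaAntidiagonalEquivProd (A := ℕ)).hasSum_iff]
  exact hs'.hasSum

/-! ### Geometric ratios, coefficients and their majorant -/

/-- The ratio `(-1)^k φ^(-(s + j + 2k))` of the geometric series attached to `(j, k)`. -/
noncomputable def fibRatio (p : ℕ × ℕ) (s : ℂ) : ℂ :=
  (-1) ^ p.2 * Complex.exp (-(Real.log Real.goldenRatio * (s + p.1 + 2 * p.2)))

/-- The coefficient of index `(j, k)` in the expansion of `(1 + √5 z x - ε x²)^(-s)`. -/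
noncomputable def fibCoeff (z : ℂ) (p : ℕ × ℕ) (s : ℂ) : ℂ :=
  Ring.choose (-s) (p.1 + p.2) * (p.1 + p.2).choose p.2 * ((√5 : ℝ) * z) ^ p.1 * (-1) ^ p.2

theorem log_goldenRatio_pos : 0 < Real.log Real.goldenRatio :=
  Real.log_pos Real.one_lt_goldenRatio

theorem exp_neg_log_goldenRatio :
    Complex.exp (-(Real.log Real.goldenRatio : ℂ)) = (Real.goldenRatio⁻¹ : ℝ) := by
  rw [← Complex.ofReal_neg, ← Complex.ofReal_exp, Real.exp_neg, Real.exp_log Real.goldenRatio_pos]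

theorem fibRatio_eq (p : ℕ × ℕ) (s : ℂ) :
    fibRatio p s = (-1) ^ p.2 * (Complex.exp (-(Real.log Real.goldenRatio * s)) *
      (Real.goldenRatio⁻¹ : ℝ) ^ p.1 * ((Real.goldenRatio⁻¹ : ℝ) ^ 2) ^ p.2) := by
  rw [fibRatio, ← exp_neg_log_goldenRatio, ← pow_mul, ← Complex.exp_nat_mul, ← Complex.exp_nat_mul,
    ← Complex.exp_add, ← Complex.exp_add]
  push_cast
  ring_nf

theorem norm_fibRatio (p : ℕ × ℕ) (s : ℂ) :
    ‖fibRatio p s‖ = Real.exp (-(Real.log Real.goldenRatio * (s.re + p.1 + 2 * p.2))) := by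
  simp [fibRatio, Complex.norm_exp]

theorem norm_fibRatio_eq (p : ℕ × ℕ) (s : ℂ) :
    ‖fibRatio p s‖ = Real.exp (-(Real.log Real.goldenRatio * s.re)) *
      Real.goldenRatio⁻¹ ^ p.1 * (Real.goldenRatio⁻¹ ^ 2) ^ p.2 := by
  rw [fibRatio_eq]
  have hφ := Real.goldenRatio_pos
  generalize Real.goldenRatio = φ at hφ ⊢
  simp [Complex.norm_exp, abs_of_pos hφ]

theorem norm_fibRatio_le (p : ℕ × ℕ) (s : ℂ) :
    ‖fibRatio p s‖ ≤ Real.exp (-(Real.log Real.goldenRatio * s.re)) := by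
  rw [norm_fibRatio]
  have := log_goldenRatio_pos
  gcongr
  linarith [Nat.cast_nonneg (α := ℝ) p.1, Nat.cast_nonneg (α := ℝ) p.2]

/-- The power `N` of the ratio shrinks `√5 ‖z‖` by `φ^(-N)`, which brings a large `z` inside the
region of convergence. -/
theorem norm_fibCoeff_mul_fibRatio_pow_le (z : ℂ) {s : ℂ} {R : ℝ} (h : ‖s‖ ≤ R) (N : ℕ)
    (p : ℕ × ℕ) :
    ‖fibCoeff z p s * fibRatio p s ^ N‖ ≤ Real.exp (Real.log Real.goldenRatio * R) ^ N *
      (‖Ring.choose (-(R : ℂ)) (p.1 + p.2)‖ * (p.1 + p.2).choose p.2 *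
        (√5 * ‖z‖ * Real.goldenRatio⁻¹ ^ N) ^ p.1 * ((Real.goldenRatio⁻¹ ^ N) ^ 2) ^ p.2) := by
  have h1 := norm_choose_neg_le h (p.1 + p.2)
  have hφ := Real.goldenRatio_pos
  have hL := log_goldenRatio_pos
  have h2 : -(Real.log Real.goldenRatio * s.re) ≤ Real.log Real.goldenRatio * R := by
    rw [← mul_neg]
    gcongr
    exact (neg_le_abs _).trans ((Complex.abs_re_le_norm s).trans h)
  rw [norm_mul, norm_pow, norm_fibRatio_eq, fibCoeff]
  simp only [norm_mul, norm_pow, norm_neg, norm_one, one_pow, mul_one, Complex.norm_natCast,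
    Complex.norm_real, Real.norm_of_nonneg (Real.sqrt_nonneg 5)]
  calc _ ≤ ‖Ring.choose (-(R : ℂ)) (p.1 + p.2)‖ * (p.1 + p.2).choose p.2 * (√5 * ‖z‖) ^ p.1 *
        (Real.exp (Real.log Real.goldenRatio * R) * Real.goldenRatio⁻¹ ^ p.1 *
          (Real.goldenRatio⁻¹ ^ 2) ^ p.2) ^ N := by gcongr
    _ = _ := by
      simp only [mul_pow, ← pow_mul]
      ring_nf

theorem summable_fibMajorant (R : ℝ) {z : ℂ} {N : ℕ}
    (hN : √5 * ‖z‖ * Real.goldenRatio⁻¹ ^ N + (Real.goldenRatio⁻¹ ^ N) ^ 2 < 1) :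
    Summable fun p : ℕ × ℕ => ‖Ring.choose (-(R : ℂ)) (p.1 + p.2)‖ * (p.1 + p.2).choose p.2 *
        (√5 * ‖z‖ * Real.goldenRatio⁻¹ ^ N) ^ p.1 * ((Real.goldenRatio⁻¹ ^ N) ^ 2) ^ p.2 := by
  have hφ := Real.goldenRatio_pos
  exact summable_double_binomial _ (by positivity) (by positivity) hN

theorem exists_goldenRatio_pow_lt (z : ℂ) :
    ∃ N : ℕ, √5 * ‖z‖ * Real.goldenRatio⁻¹ ^ N + (Real.goldenRatio⁻¹ ^ N) ^ 2 < 1 := by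
  have h : Tendsto (fun N : ℕ => Real.goldenRatio⁻¹ ^ N) atTop (𝓝 0) :=
    tendsto_pow_atTop_nhds_zero_of_lt_one (inv_nonneg.2 Real.goldenRatio_pos.le)
      (inv_lt_one_of_one_lt₀ Real.one_lt_goldenRatio)
  have h2 := (h.const_mul (√5 * ‖z‖)).add (h.pow 2)
  simp only [mul_zero, ne_eq, OfNat.ofNat_ne_zero, not_false_eq_true, zero_pow, add_zero] at h2
  exact (h2.eventually_lt_const one_pos).exists

/-! ### Binet expansion and summation over `n` for `Re s > 0` -/

theorem add_fib_eq (z : ℂ) (n : ℕ) :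
    z + (Nat.fib n : ℂ) = ((Real.goldenRatio ^ n / √5 : ℝ) : ℂ) *
      (1 + ((√5 : ℝ) * z * (Real.goldenRatio⁻¹ : ℝ) ^ n +
        -(-1) ^ n * ((Real.goldenRatio⁻¹ : ℝ) ^ n) ^ 2)) := by
  have hφ : (Real.goldenRatio : ℂ) ≠ 0 := by exact_mod_cast Real.goldenRatio_ne_zero
  have h5 : ((√5 : ℝ) : ℂ) ≠ 0 := by
    exact_mod_cast (Real.sqrt_pos.2 (by norm_num : (0 : ℝ) < 5)).ne'
  have hF : (Nat.fib n : ℂ) = (Real.goldenRatio ^ n - (-(Real.goldenRatio⁻¹ : ℝ)) ^ n) /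
      (√5 : ℝ) := by
    rw [Real.inv_goldenRatio]
    have := congrArg (Complex.ofReal) (Real.coe_fib_eq n)
    push_cast at this ⊢
    rw [this]
    simp
  rw [hF, neg_pow]
  generalize Real.goldenRatio = φ at hφ ⊢
  push_cast
  simp only [inv_pow]
  field_simp
  ring

theorem hasSum_fibCoeff_mul_fibRatio_pow {z : ℂ} {n : ℕ}
    (hn : √5 * ‖z‖ * Real.goldenRatio⁻¹ ^ n + (Real.goldenRatio⁻¹ ^ n) ^ 2 < 1) (s : ℂ) :
    HasSum (fun p => Complex.exp (s * Real.log √5) * (fibCoeff z p s * fibRatio p s ^ n))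
      ((z + (Nat.fib n : ℂ)) ^ (-s)) := by
  have hφ := Real.goldenRatio_pos
  set a : ℂ := (√5 : ℝ) * z * (Real.goldenRatio⁻¹ : ℝ) ^ n with ha
  set b : ℂ := -(-1) ^ n * ((Real.goldenRatio⁻¹ : ℝ) ^ n) ^ 2 with hb
  have hab : ‖a‖ + ‖b‖ < 1 := by
    rw [ha, hb]
    generalize Real.goldenRatio = φ at hφ hn ⊢
    simpa [abs_of_pos hφ, abs_of_nonneg (Real.sqrt_nonneg 5)] using hn
  have h1 : 1 + (a + b) ≠ 0 := by
    intro h0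
    have : a + b = -1 := by linear_combination h0
    have h2 := (norm_add_le a b).trans_lt hab
    rw [this] at h2
    simp at h2
  have h5 : 0 < √5 := Real.sqrt_pos.2 (by norm_num)
  have hc : 0 < Real.goldenRatio ^ n / √5 := by positivity
  have hz : z + (Nat.fib n : ℂ) ≠ 0 := by
    rw [add_fib_eq]
    exact mul_ne_zero (by exact_mod_cast hc.ne') h1
  -- A positive real factor splits off the principal logarithm without a branch correction.
  have key : (z + (Nat.fib n : ℂ)) ^ (-s) = Complex.exp (s * Real.log √5) *
      Complex.exp (-(Real.log Real.goldenRatio * s)) ^ n * (1 + (a + b)) ^ (-s) := by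
    rw [Complex.cpow_def_of_ne_zero hz, Complex.cpow_def_of_ne_zero h1, add_fib_eq,
      Complex.log_ofReal_mul hc h1, Real.log_div (by positivity) (by positivity), Real.log_pow,
      ← Complex.exp_nat_mul, ← Complex.exp_add, ← Complex.exp_add]
    push_cast
    ring_nf
  rw [key]
  refine ((hasSum_double_binomial (-s) hab).mul_left (Complex.exp (s * Real.log √5) *
      Complex.exp (-(Real.log Real.goldenRatio * s)) ^ n)).congr_fun fun p => ?_
  rw [fibRatio_eq, fibCoeff, ha, hb]
  have h3 : ((-1 : ℂ) ^ n) ^ p.2 = ((-1) ^ p.2) ^ n := by rw [← pow_mul, ← pow_mul, mul_comm]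
  rw [neg_mul, neg_pow ((-1 : ℂ) ^ n * _)]
  simp only [mul_pow, h3]
  ring

theorem hasSum_add_fib_cpow {z : ℂ} {N : ℕ}
    (hN : √5 * ‖z‖ * Real.goldenRatio⁻¹ ^ N + (Real.goldenRatio⁻¹ ^ N) ^ 2 < 1) {s : ℂ}
    (hs : 0 < s.re) :
    HasSum (fun n : ℕ => (z + (Nat.fib (n + N) : ℂ)) ^ (-s)) (Complex.exp (s * Real.log √5) *
      ∑' p, fibCoeff z p s * (fibRatio p s ^ N / (1 - fibRatio p s))) := by
  have hq0 : 0 < Real.goldenRatio⁻¹ := inv_pos.2 Real.goldenRatio_pos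
  have hq1 : Real.goldenRatio⁻¹ ≤ 1 := inv_le_one_of_one_le₀ Real.one_lt_goldenRatio.le
  have hr : Real.exp (-(Real.log Real.goldenRatio * s.re)) < 1 := by
    rw [Real.exp_lt_one_iff]
    have := mul_pos log_goldenRatio_pos hs
    linarith
  have hsum : Summable fun x : ℕ × (ℕ × ℕ) =>
      fibCoeff z x.2 s * fibRatio x.2 s ^ (x.1 + N) := by
    have h1 : Summable fun p => ‖fibCoeff z p s * fibRatio p s ^ N‖ :=
      .of_nonneg_of_le (fun _ => norm_nonneg _)
        (fun p => norm_fibCoeff_mul_fibRatio_pow_le z le_rfl N p)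
        ((summable_fibMajorant ‖s‖ hN).mul_left _)
    have h2 := (summable_geometric_of_lt_one (Real.exp_pos _).le hr).mul_of_nonneg h1
      (fun _ => by positivity) (fun _ => norm_nonneg _)
    refine .of_norm_bounded h2 fun x => ?_
    rw [pow_add, mul_left_comm, norm_mul, norm_pow]
    gcongr
    exact norm_fibRatio_le _ _
  have hsum' := hsum.mul_left (Complex.exp (s * Real.log √5))
  have hn : ∀ n, √5 * ‖z‖ * Real.goldenRatio⁻¹ ^ (n + N) + (Real.goldenRatio⁻¹ ^ (n + N)) ^ 2 < 1 :=
    fun n => by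
      have := pow_le_pow_of_le_one hq0.le hq1 (Nat.le_add_left N n)
      refine lt_of_le_of_lt ?_ hN
      gcongr
  have h3 := hsum'.hasSum.prod_fiberwise fun n => hasSum_fibCoeff_mul_fibRatio_pow (hn n) s
  -- Fubini: for fixed `p`, the sum over `n` is geometric.
  have hsw := (Equiv.prodComm (ℕ × ℕ) ℕ).summable_iff.2 hsum
  have h4 := hsw.hasSum.prod_fiberwise (g := fun p => fibCoeff z p s *
      (fibRatio p s ^ N / (1 - fibRatio p s))) fun p => by
    have hp : ‖fibRatio p s‖ < 1 := (norm_fibRatio_le p s).trans_lt hr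
    rw [show fibCoeff z p s * (fibRatio p s ^ N / (1 - fibRatio p s)) =
      fibCoeff z p s * fibRatio p s ^ N * (1 - fibRatio p s)⁻¹ by ring]
    refine ((hasSum_geometric_of_norm_lt_one hp).mul_left
      (fibCoeff z p s * fibRatio p s ^ N)).congr_fun fun n => ?_
    simp only [Function.comp, Equiv.prodComm_apply, Prod.swap_prod_mk, pow_add]
    ring
  have h5 := h4.tsum_eq.trans ((Equiv.prodComm (ℕ × ℕ) ℕ).tsum_eq (fun x : ℕ × (ℕ × ℕ) =>
      fibCoeff z x.2 s * fibRatio x.2 s ^ (x.1 + N)))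
  rw [h5, ← tsum_mul_left]
  exact h3

/-! ### Local structure of the continuation -/

/-- The term of index `p` in the continued Fibonacci zeta function, up to `5 ^ (s / 2)`. -/
noncomputable def fibTerm (z : ℂ) (N : ℕ) (p : ℕ × ℕ) (s : ℂ) : ℂ :=
  fibCoeff z p s * (fibRatio p s ^ N / (1 - fibRatio p s))

/-- The continuation of the Fibonacci zeta function whose first `N` terms are split off. -/
noncomputable def fibZetaAux (z : ℂ) (N : ℕ) (s : ℂ) : ℂ :=
  ∑ n ∈ Finset.range N, (z + (Nat.fib n : ℂ)) ^ (-s) +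
    Complex.exp (s * Real.log √5) * ∑' p, fibTerm z N p s

theorem differentiable_fibRatio (p : ℕ × ℕ) : Differentiable ℂ (fibRatio p) := by
  unfold fibRatio
  fun_prop

theorem differentiable_fibCoeff (z : ℂ) (p : ℕ × ℕ) : Differentiable ℂ (fibCoeff z p) := by
  have := differentiable_choose_neg (p.1 + p.2)
  unfold fibCoeff
  fun_prop

theorem hasDerivAt_fibRatio (p : ℕ × ℕ) (s : ℂ) :
    HasDerivAt (fibRatio p) (-Real.log Real.goldenRatio * fibRatio p s) s := by
  have h : HasDerivAt (fun s : ℂ => -(Real.log Real.goldenRatio * (s + p.1 + 2 * p.2)))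
      (-(Real.log Real.goldenRatio * 1 : ℂ)) s :=
    ((((hasDerivAt_id s).add_const _).add_const _).const_mul _).neg
  refine (h.cexp.const_mul ((-1 : ℂ) ^ p.2)).congr_deriv ?_
  rw [fibRatio]
  ring

theorem analyticAt_fibTerm (z : ℂ) (N : ℕ) {p : ℕ × ℕ} {s : ℂ} (h : fibRatio p s ≠ 1) :
    AnalyticAt ℂ (fibTerm z N p) s := by
  have h1 := (differentiable_fibRatio p).analyticAt s
  exact ((differentiable_fibCoeff z p).analyticAt s).mul
    ((h1.pow N).div (analyticAt_const.sub h1) (sub_ne_zero.2 h.symm))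

theorem meromorphicAt_fibTerm (z : ℂ) (N : ℕ) (p : ℕ × ℕ) (s : ℂ) :
    MeromorphicAt (fibTerm z N p) s := by
  have h1 := (differentiable_fibRatio p).analyticAt s
  exact ((differentiable_fibCoeff z p).analyticAt s).meromorphicAt.mul
    ((h1.pow N).meromorphicAt.div (analyticAt_const.sub h1).meromorphicAt)

/-- At such a point the ratio has derivative `-log φ`, so `1 - fibRatio` has a simple zero with
slope `log φ`; the numerator power is `1` there. -/
theorem tendsto_sub_mul_fibTerm (z : ℂ) (N : ℕ) {p : ℕ × ℕ} {s₀ : ℂ} (h : fibRatio p s₀ = 1) :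
    Tendsto (fun s => (s - s₀) * fibTerm z N p s) (𝓝[≠] s₀)
      (𝓝 (fibCoeff z p s₀ / Real.log Real.goldenRatio)) := by
  have hL : (Real.log Real.goldenRatio : ℂ) ≠ 0 := by exact_mod_cast log_goldenRatio_pos.ne'
  have h1 := (hasDerivAt_fibRatio p s₀).tendsto_slope
  rw [h, mul_one] at h1
  have h2 := h1.neg.inv₀ (by simpa using hL)
  have h3 : Tendsto (fun s => fibCoeff z p s * fibRatio p s ^ N) (𝓝[≠] s₀)
      (𝓝 (fibCoeff z p s₀ * fibRatio p s₀ ^ N)) :=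
    (((differentiable_fibCoeff z p).continuous.mul
      ((differentiable_fibRatio p).continuous.pow N)).tendsto s₀).mono_left nhdsWithin_le_nhds
  have h4 := h3.mul h2
  rw [h, one_pow, mul_one, neg_neg, ← div_eq_mul_inv] at h4
  refine h4.congr fun s => ?_
  rw [fibTerm, slope_def_field, h, ← neg_div, neg_sub, inv_div]
  ring

theorem exists_norm_fibRatio_le_half (R : ℝ) :
    ∃ S : Finset (ℕ × ℕ), ∀ p ∉ S, ∀ s : ℂ, ‖s‖ ≤ R → ‖fibRatio p s‖ ≤ 1 / 2 := by
  have hL := log_goldenRatio_pos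
  obtain ⟨K, hK⟩ := exists_nat_ge (R + Real.log 2 / Real.log Real.goldenRatio)
  refine ⟨Finset.range K ×ˢ Finset.range K, fun p hp s hs => ?_⟩
  -- Outside the square one of the two indices is already at least `K`.
  have hp' : (K : ℝ) ≤ p.1 + 2 * p.2 := by
    have : K ≤ p.1 + 2 * p.2 := by
      simp only [Finset.mem_product, Finset.mem_range] at hp
      omega
    exact_mod_cast this
  have hre : -R ≤ s.re := by
    have := Complex.abs_re_le_norm s
    linarith [neg_abs_le s.re]
  have h1 : Real.log 2 / Real.log Real.goldenRatio ≤ s.re + p.1 + 2 * p.2 := by linarith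
  rw [div_le_iff₀' hL] at h1
  rw [norm_fibRatio, one_div, ← Real.exp_log (show (0 : ℝ) < 2⁻¹ by norm_num), Real.log_inv]
  gcongr

theorem exists_finset_mem_iff_fibRatio_eq_one (s : ℂ) :
    ∃ P : Finset (ℕ × ℕ), ∀ p, p ∈ P ↔ fibRatio p s = 1 := by
  classical
  obtain ⟨S, hS⟩ := exists_norm_fibRatio_le_half ‖s‖
  refine ⟨S.filter fun p => fibRatio p s = 1, fun p => ?_⟩
  rw [Finset.mem_filter, and_iff_right_iff_imp]
  intro h
  by_contra hp
  have := hS p hp s le_rfl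
  rw [h] at this
  norm_num at this

/-- Near `s₀` all but finitely many ratios are at most `1/2` in norm, so the remaining terms
converge normally to a holomorphic function; only the indices in `P` can be singular at `s₀`. -/
theorem fibZetaAux_eventuallyEq {z : ℂ} (hz : z ∈ Complex.slitPlane) {N : ℕ}
    (hN : √5 * ‖z‖ * Real.goldenRatio⁻¹ ^ N + (Real.goldenRatio⁻¹ ^ N) ^ 2 < 1) (s₀ : ℂ)
    {P : Finset (ℕ × ℕ)} (hP : ∀ p, p ∈ P ↔ fibRatio p s₀ = 1) :
    ∃ h : ℂ → ℂ, AnalyticAt ℂ h s₀ ∧ fibZetaAux z N =ᶠ[𝓝 s₀] fun s =>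
      h s + Complex.exp (s * Real.log √5) * ∑ p ∈ P, fibTerm z N p s := by
  classical
  set R := ‖s₀‖ + 1 with hR
  obtain ⟨S', hS'⟩ := exists_norm_fibRatio_le_half R
  set S := S' ∪ P with hSdef
  have hball : Metric.ball (0 : ℂ) R ∈ 𝓝 s₀ := Metric.isOpen_ball.mem_nhds (by simp [hR])
  have hnorm : ∀ s ∈ Metric.ball (0 : ℂ) R, ‖s‖ ≤ R := fun s hs => (mem_ball_zero_iff.1 hs).le
  set C := Real.exp (Real.log Real.goldenRatio * R) ^ N
  -- The factor `2` bounds `1 / ‖1 - fibRatio‖` when the ratio is at most `1/2`.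
  have hmaj := ((summable_fibMajorant R hN).mul_left (C * 2)).subtype (· ∉ S)
  have hhalf : ∀ p : {p // p ∉ S}, ∀ s ∈ Metric.ball (0 : ℂ) R, ‖fibRatio p s‖ ≤ 1 / 2 :=
    fun p s hs => hS' p (fun h => p.2 (Finset.mem_union_left _ h)) s (hnorm s hs)
  have hbound : ∀ (p : {p // p ∉ S}), ∀ s ∈ Metric.ball (0 : ℂ) R, ‖fibTerm z N p s‖ ≤ C * 2 *
      (‖Ring.choose (-(R : ℂ)) (p.1.1 + p.1.2)‖ * (p.1.1 + p.1.2).choose p.1.2 *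
        (√5 * ‖z‖ * Real.goldenRatio⁻¹ ^ N) ^ p.1.1 *
        ((Real.goldenRatio⁻¹ ^ N) ^ 2) ^ p.1.2) := by
    intro p s hs
    have h1 : 1 / 2 ≤ ‖1 - fibRatio p s‖ := by
      have := norm_sub_norm_le (1 : ℂ) (fibRatio p s)
      rw [norm_one] at this
      linarith [hhalf p s hs]
    have h2 := norm_fibCoeff_mul_fibRatio_pow_le z (hnorm s hs) N p
    rw [fibTerm, ← mul_div_assoc, norm_div, div_le_iff₀ (by linarith)]
    refine h2.trans ?_
    have h3 := (norm_nonneg _).trans h2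
    nlinarith
  have htail : DifferentiableOn ℂ (fun s => ∑' p : {p // p ∉ S}, fibTerm z N p s)
      (Metric.ball 0 R) :=
    Complex.differentiableOn_tsum_of_summable_norm hmaj (fun p s hs =>
      (analyticAt_fibTerm z N (fun h => by
        have := hhalf p s hs
        rw [h] at this
        norm_num at this)).differentiableAt.differentiableWithinAt)
      Metric.isOpen_ball (fun p s hs => hbound p s hs)
  have hE : AnalyticAt ℂ (fun s : ℂ => Complex.exp (s * Real.log √5)) s₀ :=
    (by fun_prop : Differentiable ℂ fun s : ℂ => Complex.exp (s * Real.log √5)).analyticAt s₀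
  refine ⟨fun s => ∑ n ∈ Finset.range N, (z + (Nat.fib n : ℂ)) ^ (-s) +
    Complex.exp (s * Real.log √5) * (∑ p ∈ S \ P, fibTerm z N p s +
      ∑' p : {p // p ∉ S}, fibTerm z N p s), ?_, ?_⟩
  · refine AnalyticAt.add ?_ (hE.mul (AnalyticAt.add ?_ ?_))
    · refine Finset.analyticAt_fun_sum _ fun n _ => ?_
      have hne : z + (Nat.fib n : ℂ) ≠ 0 := by
        intro h0
        rw [Complex.mem_slitPlane_iff] at hz
        have h1 := congrArg Complex.re h0
        have h2 := congrArg Complex.im h0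
        simp at h1 h2
        rcases hz with hz | hz
        · linarith [Nat.cast_nonneg (α := ℝ) (Nat.fib n)]
        · exact hz h2
      have : Differentiable ℂ fun s : ℂ => (z + (Nat.fib n : ℂ)) ^ (-s) := fun s =>
        differentiableAt_id.neg.const_cpow (.inl hne)
      exact this.analyticAt s₀
    · refine Finset.analyticAt_fun_sum _ fun p hp => analyticAt_fibTerm z N fun h => ?_
      exact (Finset.mem_sdiff.1 hp).2 ((hP p).2 h)
    · exact htail.analyticAt hball
  · filter_upwards [hball] with s hs
    have h1 : Summable fun p : {p // p ∉ S} => fibTerm z N p s :=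
      .of_norm_bounded hmaj fun p => hbound p s hs
    have h2 : Summable fun p => fibTerm z N p s := (Finset.summable_compl_iff S).1 h1
    have h3 := h2.sum_add_tsum_subtype_compl S
    rw [fibZetaAux, ← h3, ← Finset.sum_sdiff (Finset.subset_union_right : P ⊆ S)]
    ring

theorem meromorphicAt_fibZetaAux {z : ℂ} (hz : z ∈ Complex.slitPlane) {N : ℕ}
    (hN : √5 * ‖z‖ * Real.goldenRatio⁻¹ ^ N + (Real.goldenRatio⁻¹ ^ N) ^ 2 < 1) (s : ℂ) :
    MeromorphicAt (fibZetaAux z N) s := by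
  obtain ⟨P, hP⟩ := exists_finset_mem_iff_fibRatio_eq_one s
  obtain ⟨h, hh, he⟩ := fibZetaAux_eventuallyEq hz hN s hP
  refine MeromorphicAt.congr ?_ (he.symm.filter_mono nhdsWithin_le_nhds)
  have hE : Differentiable ℂ fun s : ℂ => Complex.exp (s * Real.log √5) := by fun_prop
  exact hh.meromorphicAt.add ((hE.analyticAt s).meromorphicAt.mul
    (MeromorphicAt.fun_sum fun p _ => meromorphicAt_fibTerm z N p s))

theorem analyticAt_fibZetaAux {z : ℂ} (hz : z ∈ Complex.slitPlane) {N : ℕ}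
    (hN : √5 * ‖z‖ * Real.goldenRatio⁻¹ ^ N + (Real.goldenRatio⁻¹ ^ N) ^ 2 < 1) {s : ℂ}
    (hs : ∀ p, fibRatio p s ≠ 1) : AnalyticAt ℂ (fibZetaAux z N) s := by
  obtain ⟨h, hh, he⟩ := fibZetaAux_eventuallyEq hz hN s (P := ∅) (by simpa using hs)
  simp only [Finset.sum_empty, mul_zero, add_zero] at he
  exact hh.congr he.symm

theorem tendsto_sub_mul_fibZetaAux {z : ℂ} (hz : z ∈ Complex.slitPlane) {N : ℕ}
    (hN : √5 * ‖z‖ * Real.goldenRatio⁻¹ ^ N + (Real.goldenRatio⁻¹ ^ N) ^ 2 < 1) {s₀ : ℂ}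
    {P : Finset (ℕ × ℕ)} (hP : ∀ p, p ∈ P ↔ fibRatio p s₀ = 1) :
    Tendsto (fun s => (s - s₀) * fibZetaAux z N s) (𝓝[≠] s₀)
      (𝓝 (Complex.exp (s₀ * Real.log √5) *
        ∑ p ∈ P, fibCoeff z p s₀ / Real.log Real.goldenRatio)) := by
  obtain ⟨h, hh, he⟩ := fibZetaAux_eventuallyEq hz hN s₀ hP
  have hE : Continuous fun s : ℂ => Complex.exp (s * Real.log √5) := by fun_prop
  have h1 : Tendsto (fun s => (s - s₀) * h s) (𝓝[≠] s₀) (𝓝 ((s₀ - s₀) * h s₀)) :=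
    ((by fun_prop : ContinuousAt (fun s : ℂ => s - s₀) s₀).mul
      hh.continuousAt).tendsto.mono_left nhdsWithin_le_nhds
  have h2 := ((hE.tendsto s₀).mono_left nhdsWithin_le_nhds).mul
    (tendsto_finsetSum P fun p hp => tendsto_sub_mul_fibTerm z N ((hP p).1 hp))
  have h3 := h1.add h2
  rw [sub_self, zero_mul, zero_add] at h3
  refine h3.congr' ?_
  filter_upwards [he.filter_mono nhdsWithin_le_nhds] with s hs
  rw [hs, ← Finset.mul_sum]
  ring

/-! ### From limits to pole orders -/

theorem HasSimpleResidueAt.of_tendsto {f : ℂ → ℂ} {p r : ℂ} (hf : MeromorphicAt f p)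
    (h : Tendsto (fun s => (s - p) * f s) (𝓝[≠] p) (𝓝 r)) : HasSimpleResidueAt f p r := by
  refine ⟨hf, ?_, h⟩
  have hg : MeromorphicAt (fun s : ℂ => s - p) p := by fun_prop
  have h1 := (tendsto_nhds_iff_meromorphicOrderAt_nonneg (hg.mul hf)).1 ⟨r, h⟩
  rw [meromorphicOrderAt_mul hg hf, show meromorphicOrderAt (fun s : ℂ => s - p) p = 1 from
    meromorphicOrderAt_id_sub_const] at h1
  cases ho : meromorphicOrderAt f p with
  | top => exact le_top
  | coe n =>
    rw [ho] at h1
    norm_cast at h1 ⊢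
    have : (-1 : WithTop ℤ) = ((-1 : ℤ) : WithTop ℤ) := rfl
    rw [this]
    norm_cast
    omega

theorem HasSimpleResidueAt.hasSimplePoleAt {f : ℂ → ℂ} {p r : ℂ} (h : HasSimpleResidueAt f p r)
    (hr : r ≠ 0) : HasSimplePoleAt f p := by
  obtain ⟨hf, -, h⟩ := h
  refine ⟨hf, ?_⟩
  have hg : MeromorphicAt (fun s : ℂ => s - p) p := by fun_prop
  have h1 := (tendsto_ne_zero_iff_meromorphicOrderAt_eq_zero (hg.mul hf)).1 ⟨r, hr, h⟩
  rw [meromorphicOrderAt_mul hg hf, show meromorphicOrderAt (fun s : ℂ => s - p) p = 1 from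
    meromorphicOrderAt_id_sub_const] at h1
  cases ho : meromorphicOrderAt f p with
  | top => rw [ho] at h1; simp at h1
  | coe n =>
    rw [ho] at h1
    norm_cast at h1
    have : (-1 : WithTop ℤ) = ((-1 : ℤ) : WithTop ℤ) := rfl
    rw [this]
    norm_cast
    omega

/-! ### Location of the poles -/

theorem fibRatio_eq_one_iff (p : ℕ × ℕ) (s : ℂ) :
    fibRatio p s = 1 ↔ ∃ n : ℤ, s = fibPole p.1 p.2 n := by
  have hL : (Real.log Real.goldenRatio : ℂ) ≠ 0 := by exact_mod_cast log_goldenRatio_pos.ne'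
  have h1 : fibRatio p s = Complex.exp (p.2 * (Real.pi * Complex.I) -
      Real.log Real.goldenRatio * (s + p.1 + 2 * p.2)) := by
    rw [fibRatio, sub_eq_add_neg, Complex.exp_add, Complex.exp_nat_mul, Complex.exp_pi_mul_I]
  rw [h1, Complex.exp_eq_one_iff]
  unfold fibPole
  constructor
  · rintro ⟨m, hm⟩
    refine ⟨-m, mul_left_cancel₀ hL ?_⟩
    rw [mul_add, mul_div_cancel₀ _ hL]
    push_cast
    linear_combination -hm
  · rintro ⟨n, rfl⟩
    refine ⟨-n, ?_⟩
    push_cast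
    field_simp
    ring

theorem fibPole_eq_add_mul_I (j k : ℕ) (n : ℤ) :
    fibPole j k n = ((-j - 2 * k : ℝ) : ℂ) +
      (((2 * n + k) * Real.pi / Real.log Real.goldenRatio : ℝ) : ℂ) * Complex.I := by
  unfold fibPole
  push_cast
  ring

theorem fibPole_re (j k : ℕ) (n : ℤ) : (fibPole j k n).re = -j - 2 * k := by
  rw [fibPole_eq_add_mul_I, Complex.add_re, Complex.re_ofReal_mul, Complex.I_re, mul_zero,
    add_zero, Complex.ofReal_re]

theorem fibPole_im (j k : ℕ) (n : ℤ) :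
    (fibPole j k n).im = (2 * n + k) * Real.pi / Real.log Real.goldenRatio := by
  rw [fibPole_eq_add_mul_I, Complex.add_im, Complex.im_ofReal_mul, Complex.I_im, mul_one,
    Complex.ofReal_im, zero_add]

theorem fibPole_im_eq_zero_iff (j k : ℕ) (n : ℤ) :
    (fibPole j k n).im = 0 ↔ 2 * n + (k : ℤ) = 0 := by
  rw [fibPole_im, div_eq_zero_iff, or_iff_left log_goldenRatio_pos.ne', mul_eq_zero,
    or_iff_left Real.pi_ne_zero]
  norm_cast

theorem fibPole_of_two_mul_add_eq_zero (j : ℕ) {k : ℕ} {n : ℤ} (h : 2 * n + (k : ℤ) = 0) :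
    fibPole j k n = -((j + 2 * k : ℕ) : ℂ) := by
  have h' : 2 * (n : ℂ) + (k : ℂ) = 0 := by exact_mod_cast h
  rw [fibPole, h']
  push_cast
  ring

theorem mem_fibPoles_of_fibRatio_eq_one {p : ℕ × ℕ} {s : ℂ} (h : fibRatio p s = 1) :
    s ∈ fibPoles := by
  obtain ⟨n, rfl⟩ := (fibRatio_eq_one_iff p s).1 h
  by_cases hn : 2 * n + (p.2 : ℤ) = 0
  · exact .inl ⟨_, fibPole_of_two_mul_add_eq_zero _ hn⟩
  · exact .inr ⟨_, _, _, hn, rfl⟩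

theorem fibRatio_neg_natCast_eq_one_iff (p : ℕ × ℕ) (ℓ : ℕ) :
    fibRatio p (-(ℓ : ℂ)) = 1 ↔ Even p.2 ∧ p.1 + 2 * p.2 = ℓ := by
  rw [fibRatio_eq_one_iff]
  constructor
  · rintro ⟨n, hn⟩
    have h1 := (fibPole_im_eq_zero_iff p.1 p.2 n).1 (by simp [← hn])
    refine ⟨by rw [Nat.even_iff]; omega, ?_⟩
    rw [fibPole_of_two_mul_add_eq_zero _ h1, neg_inj] at hn
    exact_mod_cast hn.symm
  · rintro ⟨⟨m, hm⟩, hℓ⟩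
    refine ⟨-m, ?_⟩
    rw [fibPole_of_two_mul_add_eq_zero _ (by omega), hℓ]

/-! ### Residues as polynomials in `z` -/

/-- At `-ℓ` the index `(ℓ, 0)` gives the coefficient `1`; at a non-real point no factor `-s - r` can
vanish. -/
theorem exists_fibCoeff_ne_zero {s : ℂ} (hs : s ∈ fibPoles) :
    ∃ p, fibRatio p s = 1 ∧ Ring.choose (-s) (p.1 + p.2) ≠ 0 := by
  rcases hs with ⟨ℓ, rfl⟩ | ⟨ℓ, k, n, hn, rfl⟩
  · refine ⟨(ℓ, 0), (fibRatio_neg_natCast_eq_one_iff _ _).2 (by simp), ?_⟩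
    rw [neg_neg, add_zero, Ring.choose_natCast, Nat.choose_self]
    simp
  · exact ⟨(ℓ, k), (fibRatio_eq_one_iff _ _).2 ⟨n, rfl⟩,
      choose_neg_ne_zero (mt (fibPole_im_eq_zero_iff _ _ _).1 hn) _⟩

theorem finite_setOf_sum_fibCoeff_eq_zero {s : ℂ} (hs : s ∈ fibPoles) {P : Finset (ℕ × ℕ)}
    (hP : ∀ p, p ∈ P ↔ fibRatio p s = 1) : {z : ℂ | ∑ p ∈ P, fibCoeff z p s = 0}.Finite := by
  have h5 : ((√5 : ℝ) : ℂ) ≠ 0 := by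
    exact_mod_cast (Real.sqrt_pos.2 (by norm_num : (0 : ℝ) < 5)).ne'
  let c : ℕ × ℕ → ℂ := fun p =>
    Ring.choose (-s) (p.1 + p.2) * (p.1 + p.2).choose p.2 * (√5 : ℝ) ^ p.1 * (-1) ^ p.2
  let Q : Polynomial ℂ := ∑ p ∈ P, Polynomial.monomial p.1 (c p)
  have hQ : ∀ z, Q.eval z = ∑ p ∈ P, fibCoeff z p s := fun z => by
    rw [Polynomial.eval_finsetSum]
    refine Finset.sum_congr rfl fun p _ => ?_
    rw [Polynomial.eval_monomial, fibCoeff, mul_pow]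
    ring
  have hre : ∀ p ∈ P, s.re = -p.1 - 2 * p.2 := fun p hp => by
    obtain ⟨n, rfl⟩ := (fibRatio_eq_one_iff p s).1 ((hP p).1 hp)
    exact fibPole_re _ _ _
  have hQ0 : Q ≠ 0 := by
    obtain ⟨p₀, hp₀, hne⟩ := exists_fibCoeff_ne_zero hs
    have hp₀ := (hP p₀).2 hp₀
    have hcoeff : Q.coeff p₀.1 = c p₀ := by
      rw [Polynomial.finsetSum_coeff, Finset.sum_eq_single_of_mem p₀ hp₀,
        Polynomial.coeff_monomial_same]
      intro p hp hpp
      -- No cancellation: `j + 2k = -Re s` on `P`, so `j` determines `k`.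
      refine Polynomial.coeff_monomial_of_ne _ fun h => hpp (Prod.ext h.symm ?_)
      have h1 := (hre p hp).symm.trans (hre p₀ hp₀)
      rw [h] at h1
      have h2 : (p.2 : ℝ) = p₀.2 := by linarith
      exact_mod_cast h2
    intro h0
    rw [h0, Polynomial.coeff_zero] at hcoeff
    refine (?_ : c p₀ ≠ 0) hcoeff.symm
    have hch : ((p₀.1 + p₀.2).choose p₀.2 : ℂ) ≠ 0 := by
      exact_mod_cast (Nat.choose_pos (Nat.le_add_left _ _)).ne'
    exact mul_ne_zero (mul_ne_zero (mul_ne_zero hne hch) (pow_ne_zero _ h5))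
      (pow_ne_zero _ (by norm_num))
  refine (Polynomial.finite_setOfPred_isRoot hQ0).subset fun z hz => ?_
  exact (hQ z).trans hz

theorem residue_sum_eq (z : ℂ) (ℓ : ℕ) {P : Finset (ℕ × ℕ)}
    (hP : ∀ p, p ∈ P ↔ fibRatio p (-(ℓ : ℂ)) = 1) :
    Complex.exp (-(ℓ : ℂ) * Real.log √5) *
        ∑ p ∈ P, fibCoeff z p (-(ℓ : ℂ)) / Real.log Real.goldenRatio =
      1 / (Real.log Real.goldenRatio : ℂ) * ∑ j ∈ Finset.range (ℓ / 4 + 1),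
        (((4 * j).choose (2 * j) : ℕ) : ℂ) * ((ℓ.choose (4 * j) : ℕ) : ℂ)
          * ((5 : ℂ) ^ (2 * j))⁻¹ * z ^ (ℓ - 4 * j) := by
  have h5 : 0 < √5 := Real.sqrt_pos.2 (by norm_num)
  have h5' : ((√5 : ℝ) : ℂ) ≠ 0 := by exact_mod_cast h5.ne'
  have hsq : ((√5 : ℝ) : ℂ) ^ 2 = 5 := by
    exact_mod_cast Real.sq_sqrt (by norm_num : (0 : ℝ) ≤ 5)
  have hexp : Complex.exp (-(ℓ : ℂ) * Real.log √5) = (((√5 : ℝ) : ℂ) ^ ℓ)⁻¹ := by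
    rw [neg_mul, Complex.exp_neg, Complex.exp_nat_mul, ← Complex.ofReal_exp, Real.exp_log h5]
  rw [hexp, ← Finset.sum_div, div_eq_mul_inv, ← mul_assoc, mul_comm, ← one_div, Finset.mul_sum]
  congr 1
  symm
  -- The contributing `k` are even, `k = 2j`, and `ℓ = 4j + (ℓ - 4j)` fixes the exponent of `z`.
  refine Finset.sum_bij (fun j _ => (ℓ - 4 * j, 2 * j)) ?_ ?_ ?_ ?_
  · intro j hj
    rw [Finset.mem_range] at hj
    rw [hP, fibRatio_neg_natCast_eq_one_iff]
    exact ⟨even_two_mul j, by simp only; omega⟩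
  · intro i _ j _ h
    have := (Prod.ext_iff.1 h).2
    simp only at this
    omega
  · rintro ⟨j, k⟩ hp
    rw [hP, fibRatio_neg_natCast_eq_one_iff] at hp
    obtain ⟨⟨m, hm⟩, hℓ⟩ := hp
    simp only at hm hℓ
    exact ⟨m, Finset.mem_range.2 (by omega), Prod.ext (by simp only; omega) (by simp only; omega)⟩
  · intro j hj
    rw [Finset.mem_range] at hj
    have hj4 : 4 * j ≤ ℓ := by omega
    have hadd : ℓ - 4 * j + 2 * j = ℓ - 2 * j := by omega
    -- Both products equal the multinomial coefficient `ℓ! / ((2j)! (2j)! (ℓ - 4j)!)`.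
    have hch := Nat.choose_mul (n := ℓ) (show 2 * j ≤ 4 * j by omega)
    rw [show 4 * j - 2 * j = 2 * j by omega] at hch
    have hch' : (ℓ.choose (4 * j) : ℂ) * (4 * j).choose (2 * j) =
        ℓ.choose (2 * j) * (ℓ - 2 * j).choose (2 * j) := by exact_mod_cast hch
    have hpow : ((√5 : ℝ) : ℂ) ^ ℓ = ((√5 : ℝ) : ℂ) ^ (ℓ - 4 * j) * 5 ^ (2 * j) := by
      rw [← hsq, ← pow_mul, ← pow_add]
      congr 1
      omega
    simp only [fibCoeff, neg_neg, hadd, Ring.choose_natCast]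
    rw [Nat.choose_symm (show 2 * j ≤ ℓ by omega), hpow, mul_pow,
      (even_two_mul j).neg_one_pow, mul_comm ((4 * j).choose (2 * j) : ℂ), hch']
    field_simp

theorem mainTheorem5 :
    ∃ Z : ℂ → ℂ → ℂ,
      (∀ z ∈ Complex.slitPlane,
        -- for `Re s > 0` the series converges absolutely, with sum `Z z s`
        (∀ s : ℂ, 0 < s.re →
          Summable (fun n : ℕ => ‖(z + (Nat.fib n : ℂ)) ^ (-s)‖) ∧
          Z z s = ∑' n : ℕ, (z + (Nat.fib n : ℂ)) ^ (-s)) ∧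
        -- meromorphic on the whole plane, holomorphic off the listed points
        MeromorphicOn (Z z) Set.univ ∧
        (∀ s : ℂ, s ∉ fibPoles → AnalyticAt ℂ (Z z) s) ∧
        -- every pole is simple
        (∀ p ∈ fibPoles, -1 ≤ meromorphicOrderAt (Z z) p) ∧
        -- the residue at `-ℓ`
        (∀ ℓ : ℕ, HasSimpleResidueAt (Z z) (-(ℓ : ℂ))
          (1 / (Real.log Real.goldenRatio : ℂ) *
            ∑ j ∈ Finset.range (ℓ / 4 + 1),
              (((4 * j).choose (2 * j) : ℕ) : ℂ) * ((ℓ.choose (4 * j) : ℕ) : ℂ)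
                * ((5 : ℂ) ^ (2 * j))⁻¹ * z ^ (ℓ - 4 * j)))) ∧
      -- every listed point is a simple pole, for all but finitely many `z`
      (∀ p ∈ fibPoles,
        {z : ℂ | z ∈ Complex.slitPlane ∧ ¬ HasSimplePoleAt (Z z) p}.Finite) := by
  -- The cutoff depends on `z` alone, so one formula serves all `s`.
  choose N hN using exists_goldenRatio_pow_lt
  have hres : ∀ z ∈ Complex.slitPlane, ∀ s (P : Finset (ℕ × ℕ)),
      (∀ p, p ∈ P ↔ fibRatio p s = 1) → HasSimpleResidueAt (fibZetaAux z (N z)) s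
        (Complex.exp (s * Real.log √5) *
          ∑ p ∈ P, fibCoeff z p s / Real.log Real.goldenRatio) := fun z hz s P hP =>
    .of_tendsto (meromorphicAt_fibZetaAux hz (hN z) s) (tendsto_sub_mul_fibZetaAux hz (hN z) hP)
  refine ⟨fun z => fibZetaAux z (N z), fun z hz => ⟨fun s hs => ?_,
    fun s _ => meromorphicAt_fibZetaAux hz (hN z) s,
    fun s hs => analyticAt_fibZetaAux hz (hN z) fun p hp => hs (mem_fibPoles_of_fibRatio_eq_one hp),
    fun s _ => ?_, fun ℓ => ?_⟩, fun s hs => ?_⟩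
  · have h := hasSum_add_fib_cpow (hN z) hs
    have hsum : Summable fun n : ℕ => (z + (Nat.fib n : ℂ)) ^ (-s) :=
      (summable_nat_add_iff (N z)).1 h.summable
    refine ⟨hsum.norm, ?_⟩
    rw [← hsum.sum_add_tsum_nat_add (N z), h.tsum_eq]
    rfl
  · obtain ⟨P, hP⟩ := exists_finset_mem_iff_fibRatio_eq_one s
    exact (hres z hz s P hP).2.1
  · obtain ⟨P, hP⟩ := exists_finset_mem_iff_fibRatio_eq_one (-(ℓ : ℂ))
    rw [← residue_sum_eq z ℓ hP]
    exact hres z hz _ P hP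
  · obtain ⟨P, hP⟩ := exists_finset_mem_iff_fibRatio_eq_one s
    refine (finite_setOf_sum_fibCoeff_eq_zero hs hP).subset fun z hz => ?_
    by_contra hne
    refine hz.2 ((hres z hz.1 s P hP).hasSimplePoleAt ?_)
    rw [← Finset.sum_div]
    exact mul_ne_zero (Complex.exp_ne_zero _)
      (div_ne_zero hne (by exact_mod_cast log_goldenRatio_pos.ne'))
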